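/- Let $\mathbb N$ be the set of positive integers, $\mathcal P_f(X)$ the set of nonempty finite subsets of $X$, and $\tau={}^{\mathbb N}\mathbb N$ the set of all functions $\mathbb N\to\mathbb N$. For $F,G\in\mathcal P_f(\mathbb N)$ write $F<G$ if $\max F<\min G$. Let $\beta\mathbb N$ be the set of ultrafilters on $\mathbb N$, with $A\in p+q$ iff $\{x:\{y:x+y\in A\}\in q\}\in p$, and, for $a\in\mathbb N$, $A\in ap$ iff $\{x:ax\in A\}\in p$. A set $A\subseteq\mathbb N$ is a $J$-set if for every $F\in\mathcal P_f(\tau)$ there are $b\in\mathbb N$ and $\beta\in\mathcal P_f(\mathbb N)$ such that $b+\sum_{t\in\beta}f(t)\in A$ for all $f\in F$; $\mathcal J$ is the set of those $p\in\beta\mathbb N$ all of whose members are $J$-sets. **Theorem.** Let $m\in\mathbb N$, $a_1,\dots,a_m\in\mathbb N$ and $A\subseteq\mathbb N$. (1) The following are equivalent: (i) There are functions $\alpha:\mathcal P_f(\tau)\to\mathbb N$ and $H:\mathcal P_f(\tau)\to\mathcal P_f(\mathbb N)$ such that $H(F)<H(G)$ whenever $F,G\in\mathcal P_f(\tau)$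 and $F\subsetneq G$, and such that for every sequence $G_1\subsetneq G_2\subsetneq\cdots$ in $\mathcal P_f(\tau)$, all $\beta_1<\dots<\beta_m$ in $\mathcal P_f(\mathbb N)$ and all $f_i\in G_i$ $(i\in\mathbb N)$, $$\sum_{j=1}^m a_j\Bigl(\sum_{i\in\beta_j}\alpha(G_i)+\sum_{i\in\beta_j}\sum_{t\in H(G_i)}f_i(t)\Bigr)\in A.$$ (ii) There is $p\in\mathcal J$ with $p+p=p$ and $A\in a_1p+a_2p+\dots+a_mp$. (2) The following are equivalent: (i) There are functions $\alpha_1,\dots,\alpha_m:\mathcal P_f(\tau)\to\mathbb N$ and $H_1,\dots,H_m:\mathcal P_f(\tau)\to\mathcal P_f(\mathbb N)$ such that $H_j(F)<H_j(G)$ for every $j$ whenever $F,G\in\mathcal P_f(\tau)$ and $F\subsetneq G$, and such that for every sequence $G_1\subsetneq G_2\subsetneq\cdots$ in $\mathcal P_f(\tau)$, all $\beta_1<\dots<\beta_m$ in $\mathcal P_f(\mathbb N)$ and all $f_i\in G_i$ $(i\in\mathbb N)$, $$\sum_{j=1}^m a_j\Bigl(\sum_{i\in\beta_j}\alpha_j(G_i)+\sum_{i\in\beta_j}\sum_{t\in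 H_j(G_i)}f_i(t)\Bigr)\in A.$$ (ii) There are $p_1,\dots,p_m\in\mathcal J$ with $p_j+p_j=p_j$ for every $j$ and $A\in a_1p_1+a_2p_2+\dots+a_mp_m$. (Each (i) is the case $T=\{\mathrm{id}\}$ of the condition in which, for a finite nonempty set $T$ of integer polynomials without constant term, the double sum in the $j$-th summand is replaced by $P_j$ of it and the membership is required for all $P_1,\dots,P_m\in T$.) -/

import Mathlib

/-! The positive integers are `ℕ+`, and `βℕ` is `Ultrafilter ℕ+`, with Mathlib's addition:
`A ∈ p + q ↔ {x | {y | x + y ∈ A} ∈ q} ∈ p`. -/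

attribute [local instance] Ultrafilter.add

/-- The nonempty finite subsets of `X`. -/
abbrev PosFin (X : Type) : Type := {F : Finset X // F.Nonempty}

/-- `max F < min G`, for nonempty finite sets of positive integers. -/
def Before (F G : PosFin ℕ+) : Prop := ∀ s ∈ F.1, ∀ t ∈ G.1, s < t

/-- The integer `z` is (a positive integer which is) an element of `A`. -/
def IntMem (z : ℤ) (A : Set ℕ+) : Prop := ∃ n ∈ A, (n : ℤ) = z

/-- `J`-sets. -/
def IsJSet (A : Set ℕ+) : Prop :=
  ∀ F : PosFin (ℕ+ → ℕ+), ∃ (b : ℕ+) (β : PosFin ℕ+), ∀ f ∈ F.1,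
    IntMem ((b : ℤ) + ∑ t ∈ β.1, (f t : ℤ)) A

/-- The ultrafilters all of whose members are `J`-sets. -/
def JUltrafilters : Set (Ultrafilter ℕ+) := {p | ∀ A ∈ p, IsJSet A}

/-- The ultrafilter `a p`: `A ∈ a p ↔ {x | a x ∈ A} ∈ p`. -/
def scaleUltrafilter (a : ℕ+) (p : Ultrafilter ℕ+) : Ultrafilter ℕ+ := p.map (fun x => a * x)

/-- The ultrafilter `a 0 p 0 + a 1 p 1 + ⋯ + a m p m`, in this order
(the addition of ultrafilters is associative but not commutative). -/
def linCombUltrafilter : (m : ℕ) → (Fin (m + 1) → ℕ+) → (Fin (m + 1) → Ultrafilter ℕ+) →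
    Ultrafilter ℕ+
  | 0, a, p => scaleUltrafilter (a 0) (p 0)
  | m + 1, a, p =>
      scaleUltrafilter (a 0) (p 0) +
        linCombUltrafilter m (fun i => a i.succ) (fun i => p i.succ)

/-- Polynomials with integer coefficients and no constant term. -/
abbrev PolyZero : Type := {P : Polynomial ℤ // P.coeff 0 = 0}

/-- The polynomial `x ↦ x`. -/
noncomputable def PolyZero.ident : PolyZero := ⟨Polynomial.X, Polynomial.coeff_X_zero⟩

/-- `∑_{i ∈ β} α (G i) + P (∑_{i ∈ β} ∑_{t ∈ H (G i)} f i t)`. -/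
noncomputable def blockValue (α : PosFin (ℕ+ → ℕ+) → ℕ+) (H : PosFin (ℕ+ → ℕ+) → PosFin ℕ+)
    (G : ℕ+ → PosFin (ℕ+ → ℕ+)) (f : ℕ+ → ℕ+ → ℕ+) (P : PolyZero) (β : PosFin ℕ+) : ℤ :=
  (∑ i ∈ β.1, (α (G i) : ℤ)) + P.1.eval (∑ i ∈ β.1, ∑ t ∈ (H (G i)).1, (f i t : ℤ))

/-- The conclusion for `α 0, …, α m` and `H 0, …, H m`: each `H j` is increasing, and along
every strictly increasing sequence `G`, with `f i ∈ G i`, `P j ∈ T` and `β 0 < ⋯ < β m`,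
the linear combination of the block values with coefficients `a j` belongs to `A`. -/
def LinearCombinationProperty (T : PosFin PolyZero) {m : ℕ} (a : Fin (m + 1) → ℕ+) (A : Set ℕ+)
    (α : Fin (m + 1) → PosFin (ℕ+ → ℕ+) → ℕ+)
    (H : Fin (m + 1) → PosFin (ℕ+ → ℕ+) → PosFin ℕ+) : Prop :=
  (∀ F G : PosFin (ℕ+ → ℕ+), F.1 ⊂ G.1 → ∀ j, Before (H j F) (H j G)) ∧
  ∀ G : ℕ+ → PosFin (ℕ+ → ℕ+), (∀ i k, i < k → (G i).1 ⊂ (G k).1) →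
    ∀ P : Fin (m + 1) → PolyZero, (∀ j, P j ∈ T.1) →
    ∀ β : Fin (m + 1) → PosFin ℕ+, (∀ j k, j < k → Before (β j) (β k)) →
    ∀ f : ℕ+ → ℕ+ → ℕ+, (∀ i, f i ∈ (G i).1) →
      IntMem (∑ j, (a j : ℤ) * blockValue (α j) (H j) G f (P j) (β j)) A

/-- The linear-combination conclusion with one pair `α, H` used in all coordinates. -/
def SingleConclusion (T : PosFin PolyZero) {m : ℕ} (a : Fin (m + 1) → ℕ+) (A : Set ℕ+) : Prop :=
  ∃ (α : PosFin (ℕ+ → ℕ+) → ℕ+) (H : PosFin (ℕ+ → ℕ+) → PosFin ℕ+),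
    LinearCombinationProperty T a A (fun _ => α) (fun _ => H)

/-- The linear-combination conclusion with a pair `α j, H j` for each coordinate `j`. -/
def MultipleConclusion (T : PosFin PolyZero) {m : ℕ} (a : Fin (m + 1) → ℕ+) (A : Set ℕ+) : Prop :=
  ∃ (α : Fin (m + 1) → PosFin (ℕ+ → ℕ+) → ℕ+)
    (H : Fin (m + 1) → PosFin (ℕ+ → ℕ+) → PosFin ℕ+),
    LinearCombinationProperty T a A α H

/-! Both parts are instances of one equivalence in which coordinate `j` uses the ultrafilter and the
functions of index `c j`: `c` is constant for (1) and the identity for (2). A finite chain prolongs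
to an infinite sequence, so (i) only concerns sums along finite chains stacked one above another.

From (i) to (ii): the chain sums above a finite set F form a J-set, since `α G`, `H G` for a large G
serve a whole finite family with one shift and one index set. These sets shrink as F grows, and a
sum ending at E plus a sum above E is again a sum above F. As J-sets are partition regular
(Hales–Jewett), the ultrafilters in 𝒥 containing all these sets form a nonempty compact semigroup,
which has an idempotent. Membership of A is then checked one coordinate at a time.

From (ii) to (i): `α F`, `H F` are chosen by recursion on proper inclusion. Only finitely many
partial evaluations can arrive at F. By idempotence, the good continuations of each form a member of
the relevant ultrafilter; finitely many members intersect in a member, hence in a J-set, and one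
witness for F serves all of them. -/

/-! ### J-sets and their partition regularity -/

/-- The positive integer `b + ∑ t ∈ β, f t`. -/
def shiftedSum (b : ℕ+) (β : PosFin ℕ+) (f : ℕ+ → ℕ+) : ℕ+ :=
  ⟨b + ∑ t ∈ β.1, (f t : ℕ), Nat.add_pos_left b.pos _⟩

theorem coe_shiftedSum (b : ℕ+) (β : PosFin ℕ+) (f : ℕ+ → ℕ+) :
    (shiftedSum b β f : ℕ) = b + ∑ t ∈ β.1, (f t : ℕ) := rfl

theorem intMem_natCast {n : ℕ+} {z : ℤ} (h : z = ((n : ℕ) : ℤ)) {A : Set ℕ+} :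
    IntMem z A ↔ n ∈ A := by
  subst h
  constructor
  · rintro ⟨k, hk, e⟩
    have : k = n := PNat.eq (by exact_mod_cast e)
    exact this ▸ hk
  · exact fun h => ⟨n, h, rfl⟩

theorem isJSet_iff {A : Set ℕ+} : IsJSet A ↔
    ∀ F : PosFin (ℕ+ → ℕ+), ∃ b β, ∀ f ∈ F.1, shiftedSum b β f ∈ A := by
  refine forall_congr' fun F => exists_congr fun b => exists_congr fun β => forall₂_congr
    fun f _ => intMem_natCast ?_
  simp [coe_shiftedSum]

theorem IsJSet.mono {A B : Set ℕ+} (hA : IsJSet A) (h : A ⊆ B) : IsJSet B := by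
  rw [isJSet_iff] at *
  intro F
  obtain ⟨b, β, hb⟩ := hA F
  exact ⟨b, β, fun f hf => h (hb f hf)⟩

theorem not_isJSet_empty : ¬ IsJSet ∅ := by
  intro h
  obtain ⟨b, β, hb⟩ := isJSet_iff.1 h ⟨{fun _ => 1}, Finset.singleton_nonempty _⟩
  exact hb _ (Finset.mem_singleton_self _)

/-- The index set witnessing that `A` is a `J`-set may be chosen beyond any given bound. -/
theorem IsJSet.exists_gt {A : Set ℕ+} (hA : IsJSet A) (F : PosFin (ℕ+ → ℕ+)) (N : ℕ+) :
    ∃ b β, (∀ t ∈ β.1, N < t) ∧ ∀ f ∈ F.1, shiftedSum b β f ∈ A := by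
  classical
  -- Translating the functions by `N` moves the index set beyond `N`.
  obtain ⟨b, β, h⟩ := isJSet_iff.1 hA ⟨F.1.image fun f t => f (N + t), F.2.image _⟩
  refine ⟨b, ⟨β.1.image (N + ·), β.2.image _⟩, ?_, fun f hf => ?_⟩
  · simp only [Finset.mem_image]
    rintro _ ⟨t, _, rfl⟩
    exact PNat.lt_add_right N t
  · convert h _ (Finset.mem_image_of_mem _ hf) using 1
    apply PNat.eq
    simp only [coe_shiftedSum]
    rw [Finset.sum_image fun x _ y _ h => add_left_cancel h]

/-- Along a combinatorial line, the sums of the words over the coordinates are the shifted sums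
of the letters for one shift and one index set. -/
theorem exists_shiftedSum_eq_line {ι : Type} [Fintype ι] {α : Type} (φ : α → ℕ+ → ℕ+)
    (l : Combinatorics.Line α ι) (e : ℕ+ × ι → ℕ+) (he : Function.Injective e)
    (b : ℕ+) (β : PosFin ℕ+) (x₀ : α) :
    ∃ b' β', ∀ x, (shiftedSum b' β' (φ x) : ℕ) =
      b + ∑ t ∈ β.1, ∑ i, (φ (l x i) (e (t, i)) : ℕ) := by
  classical
  obtain ⟨i₀, hi₀⟩ := l.proper
  obtain ⟨t₀, ht₀⟩ := β.2
  -- The fixed coordinates contribute the same for every letter, so they go into the shift and may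
  -- be evaluated at `x₀`. The active coordinates `V` give the index set, nonempty because a line is
  -- proper.
  let V : Finset ι := Finset.univ.filter fun i => l.idxFun i = none
  obtain ⟨b', hb'⟩ : ∃ b' : ℕ+, (b' : ℕ) = b + ∑ t ∈ β.1, ∑ i ∈ Vᶜ, (φ (l x₀ i) (e (t, i)) : ℕ) :=
    ⟨⟨_, Nat.add_pos_left b.pos _⟩, rfl⟩
  refine ⟨b',
    ⟨(β.1 ×ˢ V).image e, Finset.Nonempty.image ⟨(t₀, i₀), by simp [V, ht₀, hi₀]⟩ _⟩,
    fun x => ?_⟩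
  rw [coe_shiftedSum, Finset.sum_image fun x _ y _ h => he h, Finset.sum_product,
    hb', add_assoc, ← Finset.sum_add_distrib]
  congr 1
  refine Finset.sum_congr rfl fun t _ => ?_
  rw [← Finset.sum_compl_add_sum V]
  congr 1
  · refine Finset.sum_congr rfl fun i hi => ?_
    have hi' : l.idxFun i ≠ none := by simpa [V] using hi
    obtain ⟨y, hy⟩ := Option.ne_none_iff_exists'.1 hi'
    rw [l.apply_some hy, l.apply_some hy]
  · refine Finset.sum_congr rfl fun i hi => ?_
    rw [l.apply_none _ _ (by simpa [V] using hi)]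

/-- `J`-sets are partition regular. -/
theorem IsJSet.or_of_union {A B : Set ℕ+} (h : IsJSet (A ∪ B)) : IsJSet A ∨ IsJSet B := by
  classical
  by_contra! hcon
  obtain ⟨hA, hB⟩ := hcon
  rw [isJSet_iff] at h hA hB
  push Not at hA hB
  obtain ⟨F₁, h₁⟩ := hA
  obtain ⟨F₂, h₂⟩ := hB
  let L := {f // f ∈ F₁.1 ∪ F₂.1}
  obtain ⟨f₀, hf₀⟩ := F₁.2
  let x₀ : L := ⟨f₀, Finset.mem_union_left _ hf₀⟩
  -- The letters are the functions of both counterexample families. Words are two-coloured by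
  -- whether their sum lies in `A`, so a monochromatic line defeats one of the families.
  obtain ⟨ι, _, hι⟩ := Combinatorics.Line.exists_mono_in_high_dimension L Prop
  have : Nonempty ι := by
    obtain ⟨l, -⟩ := hι fun _ => True
    exact ⟨l.proper.choose⟩
  obtain ⟨e', he'⟩ := Countable.exists_injective_nat (ℕ+ × ι)
  let e : ℕ+ × ι → ℕ+ := fun x => (e' x).succPNat
  have he : Function.Injective e := Nat.succPNat_injective.comp he'
  -- One function per word: a single pair `b`, `β` then serves all words, and `e` keeps the places
  -- used by different coordinates distinct.
  let g : (ι → L) → ℕ+ → ℕ+ := fun w t => ⟨∑ i, ((w i).1 (e (t, i)) : ℕ),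
    Finset.sum_pos (fun i _ => PNat.pos _) Finset.univ_nonempty⟩
  obtain ⟨b, β, hb⟩ := h ⟨Finset.univ.image g, ⟨g fun _ => x₀, by simp⟩⟩
  have hb' : ∀ w, shiftedSum b β (g w) ∈ A ∪ B := fun w => hb _ (by simp)
  obtain ⟨l, c, hc⟩ := hι fun w => shiftedSum b β (g w) ∈ A
  obtain ⟨b', β', hb''⟩ := exists_shiftedSum_eq_line (fun x : L => x.1) l e he b β x₀
  have key : ∀ x : L, shiftedSum b' β' x.1 = shiftedSum b β (g (l x)) := fun x =>
    PNat.eq (by rw [hb'', coe_shiftedSum]; rfl)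
  by_cases hc' : c
  · obtain ⟨f, hf, hfA⟩ := h₁ b' β'
    refine hfA ?_
    rw [key ⟨f, Finset.mem_union_left _ hf⟩]
    exact (hc _).mpr hc'
  · obtain ⟨f, hf, hfB⟩ := h₂ b' β'
    refine hfB ?_
    rw [key ⟨f, Finset.mem_union_right _ hf⟩]
    exact (hb' _).resolve_left fun h => hc' ((hc _).mp h)

/-- The translation is absorbed into the shift; this makes 𝒥 closed under addition of ultrafilters.
-/
theorem IsJSet.of_add {A : Set ℕ+} (x : ℕ+) (h : IsJSet {y | x + y ∈ A}) : IsJSet A := by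
  rw [isJSet_iff] at *
  intro F
  obtain ⟨b, β, hb⟩ := h F
  refine ⟨x + b, β, fun f hf => ?_⟩
  have : shiftedSum (x + b) β f = x + shiftedSum b β f :=
    PNat.eq (by simp [coe_shiftedSum, add_assoc])
  exact this ▸ hb f hf

/-! ### Idempotents in 𝒥 -/

theorem mem_add_ultrafilter {p q : Ultrafilter ℕ+} {A : Set ℕ+} :
    A ∈ p + q ↔ {x | {y | x + y ∈ A} ∈ q} ∈ p := Iff.rfl

/-- An antitone system of `J`-sets is contained in an ultrafilter all of whose members are
`J`-sets. -/
theorem exists_mem_JUltrafilters {ι : Type} [SemilatticeSup ι] [Nonempty ι] (S : ι → Set ℕ+)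
    (hS : Antitone S) (hJ : ∀ i, IsJSet (S i)) : ∃ p ∈ JUltrafilters, ∀ i, S i ∈ p := by
  -- The sets that are not J-sets form an ideal; `φ` is the filter dual to it, relative to the
  -- system `S`. An ultrafilter above `φ` contains the complement of every set which is not a J-set.
  let φ : Filter ℕ+ :=
    { sets := {B | ∃ i, ¬ IsJSet (S i \ B)}
      univ_sets := ⟨Classical.arbitrary ι, by simpa using not_isJSet_empty⟩
      sets_of_superset := by
        rintro B C ⟨i, hi⟩ hBC
        exact ⟨i, fun h => hi (h.mono (Set.sdiff_subset_sdiff_right hBC))⟩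
      inter_sets := by
        rintro B C ⟨i, hi⟩ ⟨j, hj⟩
        refine ⟨i ⊔ j, fun h => ?_⟩
        rw [Set.sdiff_inter] at h
        rcases h.or_of_union with h | h
        · exact hi (h.mono (Set.sdiff_subset_sdiff_left (hS le_sup_left)))
        · exact hj (h.mono (Set.sdiff_subset_sdiff_left (hS le_sup_right))) }
  have : φ.NeBot := ⟨fun h => by
    have h0 : (∅ : Set ℕ+) ∈ φ := h ▸ Filter.mem_bot
    obtain ⟨i, hi⟩ := h0
    exact hi (by simpa using hJ i)⟩
  have hle : ∀ B ∈ φ, B ∈ Ultrafilter.of φ := fun B hB => Ultrafilter.of_le φ hB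
  refine ⟨Ultrafilter.of φ, fun A hA => ?_, fun i => hle _ ⟨i, by simpa using not_isJSet_empty⟩⟩
  by_contra hn
  have : Aᶜ ∈ Ultrafilter.of φ :=
    hle _ ⟨Classical.arbitrary ι, fun h => hn (h.mono fun x hx => not_not.1 hx.2)⟩
  exact Ultrafilter.compl_notMem_iff.2 hA this

theorem isClosed_JUltrafilters : IsClosed JUltrafilters := by
  have : JUltrafilters = ⋂ A ∈ {A : Set ℕ+ | ¬ IsJSet A}, {p : Ultrafilter ℕ+ | Aᶜ ∈ p} := by
    ext p
    simp only [JUltrafilters, Set.mem_ofPred_eq, Set.mem_iInter, Ultrafilter.compl_mem_iff_notMem]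
    exact forall_congr' fun A => not_imp_not.symm
  rw [this]
  exact isClosed_biInter fun A _ => ultrafilter_isClosed_basic _

/-- An antitone system of `J`-sets which is a system of partial subsemigroups is contained in an
idempotent all of whose members are `J`-sets. -/
theorem exists_idempotent_mem_JUltrafilters {ι : Type} [SemilatticeSup ι] [Nonempty ι]
    (S : ι → Set ℕ+) (hS : Antitone S) (hJ : ∀ i, IsJSet (S i))
    (hadd : ∀ i, ∀ x ∈ S i, ∃ j, ∀ y ∈ S j, x + y ∈ S i) :
    ∃ p ∈ JUltrafilters, p + p = p ∧ ∀ i, S i ∈ p := by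
  let _ := Ultrafilter.addSemigroup (M := ℕ+)
  let Q : Set (Ultrafilter ℕ+) := JUltrafilters ∩ ⋂ i, {p | S i ∈ p}
  have hQ : IsClosed Q :=
    isClosed_JUltrafilters.inter (isClosed_iInter fun i => ultrafilter_isClosed_basic _)
  obtain ⟨p, hp, hpp⟩ := exists_idempotent_in_compact_add_subsemigroup
    (Ultrafilter.continuous_add_left (M := ℕ+)) Q
    (by
      obtain ⟨p, hp, h⟩ := exists_mem_JUltrafilters S hS hJ
      exact ⟨p, hp, Set.mem_iInter.2 h⟩)
    hQ.isCompact
    (by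
      rintro p ⟨hp, hpS⟩ q ⟨hq, hqS⟩
      refine ⟨fun A hA => ?_, Set.mem_iInter.2 fun i => ?_⟩
      · obtain ⟨x, hx⟩ := p.nonempty_of_mem (mem_add_ultrafilter.1 hA)
        exact (hq _ hx).of_add x
      · refine mem_add_ultrafilter.2 (Filter.mem_of_superset (Set.mem_iInter.1 hpS i) ?_)
        intro x hx
        obtain ⟨j, hj⟩ := hadd i x hx
        exact Filter.mem_of_superset (Set.mem_iInter.1 hqS j) hj)
  exact ⟨p, hp.1, hpp, Set.mem_iInter.1 hp.2⟩

/-! ### Chain sums and their idempotents -/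

/-- `ChainSum α H F E x`: the integer `x` is a sum of values `shiftedSum (α G) (H G) f`, `f ∈ G`,
along a nonempty finite chain of sets `G` which lies strictly above `F` and has last member `E`. -/
inductive ChainSum (α : PosFin (ℕ+ → ℕ+) → ℕ+) (H : PosFin (ℕ+ → ℕ+) → PosFin ℕ+)
    (F : Finset (ℕ+ → ℕ+)) : PosFin (ℕ+ → ℕ+) → ℕ+ → Prop
  | single {G : PosFin (ℕ+ → ℕ+)} {f : ℕ+ → ℕ+} (hG : F ⊂ G.1) (hf : f ∈ G.1) :
      ChainSum α H F G (shiftedSum (α G) (H G) f)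
  | step {E G : PosFin (ℕ+ → ℕ+)} {x : ℕ+} {f : ℕ+ → ℕ+} (h : ChainSum α H F E x)
      (hG : E.1 ⊂ G.1) (hf : f ∈ G.1) :
      ChainSum α H F G (x + shiftedSum (α G) (H G) f)

namespace ChainSum

variable {α : PosFin (ℕ+ → ℕ+) → ℕ+} {H : PosFin (ℕ+ → ℕ+) → PosFin ℕ+}
  {F F' : Finset (ℕ+ → ℕ+)} {E G : PosFin (ℕ+ → ℕ+)} {x y : ℕ+}

theorem anti (hF : F' ⊆ F) (h : ChainSum α H F E x) : ChainSum α H F' E x := by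
  induction h with
  | single hG hf => exact single (hF.trans_ssubset hG) hf
  | step _ hG hf ih => exact step ih hG hf

theorem add (hx : ChainSum α H F E x) (hy : ChainSum α H E.1 G y) :
    ChainSum α H F G (x + y) := by
  induction hy with
  | single hG hf => exact step hx hG hf
  | step _ hG hf ih => rw [← add_assoc]; exact step ih hG hf

end ChainSum

theorem exists_ssuperset (F : Finset (ℕ+ → ℕ+)) : ∃ G : PosFin (ℕ+ → ℕ+), F ⊂ G.1 := by
  classical
  obtain ⟨x, hx⟩ := Infinite.exists_notMem_finset F
  exact ⟨⟨insert x F, Finset.insert_nonempty _ _⟩, Finset.ssubset_insert hx⟩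

/-- Chains of length one suffice: a single G strictly above F that contains the given family. -/
theorem isJSet_chainSum (α : PosFin (ℕ+ → ℕ+) → ℕ+) (H : PosFin (ℕ+ → ℕ+) → PosFin ℕ+)
    (F : Finset (ℕ+ → ℕ+)) : IsJSet {x | ∃ E, ChainSum α H F E x} := by
  classical
  refine isJSet_iff.2 fun F' => ?_
  obtain ⟨G, hG⟩ := exists_ssuperset (F ∪ F'.1)
  exact ⟨α G, H G, fun f hf => ⟨G, .single (Finset.subset_union_left.trans_ssubset hG)
    (hG.1 (Finset.mem_union_right _ hf))⟩⟩

/-- The chain sums above arbitrary finite sets are members of a common idempotent in `𝒥`. -/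
theorem exists_idempotent_chainSum (α : PosFin (ℕ+ → ℕ+) → ℕ+)
    (H : PosFin (ℕ+ → ℕ+) → PosFin ℕ+) :
    ∃ p ∈ JUltrafilters, p + p = p ∧ ∀ F, {x | ∃ E, ChainSum α H F E x} ∈ p := by
  classical
  refine exists_idempotent_mem_JUltrafilters (fun F => {x | ∃ E, ChainSum α H F E x}) ?_
    (isJSet_chainSum α H) ?_
  · rintro F F' hF x ⟨E, hE⟩
    exact ⟨E, hE.anti hF⟩
  · rintro F x ⟨E, hE⟩
    exact ⟨E.1, fun y ⟨G, hG⟩ => ⟨G, hE.add hG⟩⟩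

/-- `x 0, …, x m` are chain sums along consecutive chains, the first of them above `F`. -/
def ConsecutiveChainSums : (m : ℕ) → (Fin (m + 1) → PosFin (ℕ+ → ℕ+) → ℕ+) →
    (Fin (m + 1) → PosFin (ℕ+ → ℕ+) → PosFin ℕ+) → Finset (ℕ+ → ℕ+) → (Fin (m + 1) → ℕ+) → Prop
  | 0, α, H, F, x => ∃ E, ChainSum (α 0) (H 0) F E (x 0)
  | m + 1, α, H, F, x => ∃ E, ChainSum (α 0) (H 0) F E (x 0) ∧
      ConsecutiveChainSums m (fun j => α j.succ) (fun j => H j.succ) E.1 (fun j => x j.succ)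

/-- The positive integer `a 0 x 0 + ⋯ + a m x m`. -/
def linCombValue : (m : ℕ) → (Fin (m + 1) → ℕ+) → (Fin (m + 1) → ℕ+) → ℕ+
  | 0, a, x => a 0 * x 0
  | m + 1, a, x => a 0 * x 0 + linCombValue m (fun j => a j.succ) (fun j => x j.succ)

theorem coe_linCombValue : ∀ (m : ℕ) (a x : Fin (m + 1) → ℕ+),
    (linCombValue m a x : ℕ) = ∑ j, (a j : ℕ) * x j
  | 0, a, x => by simp [linCombValue]
  | m + 1, a, x => by
      rw [Fin.sum_univ_succ, linCombValue, PNat.add_coe, coe_linCombValue m, PNat.mul_coe]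

theorem mem_linCombUltrafilter_zero {a : Fin 1 → ℕ+} {p : Fin 1 → Ultrafilter ℕ+} {A : Set ℕ+} :
    A ∈ linCombUltrafilter 0 a p ↔ {x | a 0 * x ∈ A} ∈ p 0 := Iff.rfl

theorem mem_linCombUltrafilter_succ {m : ℕ} {a : Fin (m + 2) → ℕ+}
    {p : Fin (m + 2) → Ultrafilter ℕ+} {A : Set ℕ+} :
    A ∈ linCombUltrafilter (m + 1) a p ↔
      {x | {z | a 0 * x + z ∈ A} ∈
        linCombUltrafilter m (fun i => a i.succ) (fun i => p i.succ)} ∈ p 0 := Iff.rfl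

/-- After a first chain sum ending at E, the remaining ones are taken above E. That E depends on the
first sum does no harm, as each ultrafilter contains the chain sums above every finite set. -/
theorem mem_linCombUltrafilter_of_consecutiveChainSums : ∀ (m : ℕ) (a : Fin (m + 1) → ℕ+)
    (p : Fin (m + 1) → Ultrafilter ℕ+) (A : Set ℕ+) (α : Fin (m + 1) → PosFin (ℕ+ → ℕ+) → ℕ+)
    (H : Fin (m + 1) → PosFin (ℕ+ → ℕ+) → PosFin ℕ+) (F : Finset (ℕ+ → ℕ+)),
    (∀ j F, {x | ∃ E, ChainSum (α j) (H j) F E x} ∈ p j) →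
    (∀ x, ConsecutiveChainSums m α H F x → linCombValue m a x ∈ A) →
    A ∈ linCombUltrafilter m a p
  | 0, a, p, A, α, H, F, hp, hA => by
      rw [mem_linCombUltrafilter_zero]
      exact Filter.mem_of_superset (hp 0 F) fun x hx => hA (fun _ => x) hx
  | m + 1, a, p, A, α, H, F, hp, hA => by
      rw [mem_linCombUltrafilter_succ]
      refine Filter.mem_of_superset (hp 0 F) fun x ⟨E, hE⟩ => ?_
      refine mem_linCombUltrafilter_of_consecutiveChainSums m _ _ _ _ _ E.1
        (fun j => hp j.succ) fun y hy => ?_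
      exact hA (Fin.cons x y) ⟨E, hE, hy⟩

/-! ### Blocks of selections versus chain sums -/

/-- `G` is a strictly increasing sequence and `f` picks a member of each of its terms. -/
def IsSelection (G : ℕ+ → PosFin (ℕ+ → ℕ+)) (f : ℕ+ → ℕ+ → ℕ+) : Prop :=
  (∀ i k, i < k → (G i).1 ⊂ (G k).1) ∧ ∀ i, f i ∈ (G i).1

/-- The value of a block, as a positive integer. -/
def blockSum (α : PosFin (ℕ+ → ℕ+) → ℕ+) (H : PosFin (ℕ+ → ℕ+) → PosFin ℕ+)
    (G : ℕ+ → PosFin (ℕ+ → ℕ+)) (f : ℕ+ → ℕ+ → ℕ+) (β : Finset ℕ+) : ℕ :=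
  ∑ i ∈ β, (shiftedSum (α (G i)) (H (G i)) (f i) : ℕ)

theorem blockValue_ident (α : PosFin (ℕ+ → ℕ+) → ℕ+) (H : PosFin (ℕ+ → ℕ+) → PosFin ℕ+)
    (G : ℕ+ → PosFin (ℕ+ → ℕ+)) (f : ℕ+ → ℕ+ → ℕ+) (β : PosFin ℕ+) :
    blockValue α H G f PolyZero.ident β = (blockSum α H G f β.1 : ℤ) := by
  simp [blockValue, blockSum, PolyZero.ident, coe_shiftedSum, Finset.sum_add_distrib]

theorem blockSum_congr {α : PosFin (ℕ+ → ℕ+) → ℕ+} {H : PosFin (ℕ+ → ℕ+) → PosFin ℕ+}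
    {G G' : ℕ+ → PosFin (ℕ+ → ℕ+)} {f f' : ℕ+ → ℕ+ → ℕ+} {β : Finset ℕ+}
    (h : ∀ i ∈ β, G' i = G i ∧ f' i = f i) : blockSum α H G' f' β = blockSum α H G f β :=
  Finset.sum_congr rfl fun i hi => by rw [(h i hi).1, (h i hi).2]

/-- Above every set there is a strictly increasing sequence starting with it. -/
theorem exists_tower (G : PosFin (ℕ+ → ℕ+)) :
    ∃ T : ℕ → PosFin (ℕ+ → ℕ+), T 0 = G ∧ ∀ i k, i < k → (T i).1 ⊂ (T k).1 := by
  choose next hnext using fun F : PosFin (ℕ+ → ℕ+) => exists_ssuperset F.1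
  refine ⟨fun n => next^[n] G, rfl, fun i k h => ?_⟩
  exact strictMono_nat_of_lt_succ (f := fun n => (next^[n] G).1)
    (fun n => by rw [Function.iterate_succ_apply']; exact hnext _) h

/-- A selection may be changed from place `N` on so as to continue with given `E` and `e`. -/
theorem IsSelection.exists_extend {G : ℕ+ → PosFin (ℕ+ → ℕ+)} {f : ℕ+ → ℕ+ → ℕ+}
    (h : IsSelection G f) {N : ℕ+} {F : Finset (ℕ+ → ℕ+)} (hN : ∀ i < N, (G i).1 ⊆ F)
    {E : PosFin (ℕ+ → ℕ+)} (hE : F ⊂ E.1) {e : ℕ+ → ℕ+} (he : e ∈ E.1) :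
    ∃ G' f', IsSelection G' f' ∧ (∀ i < N, G' i = G i ∧ f' i = f i) ∧ G' N = E ∧ f' N = e := by
  classical
  obtain ⟨T, hT0, hT⟩ := exists_tower E
  let G' : ℕ+ → PosFin (ℕ+ → ℕ+) := fun i => if i < N then G i else T ((i : ℕ) - N)
  -- Beyond place `N` the selected functions are irrelevant, so any member is taken.
  let f' : ℕ+ → ℕ+ → ℕ+ := fun i => if i < N then f i else if i = N then e else (G' i).2.choose
  have hG'N : G' N = E := by simp [G', hT0]
  refine ⟨G', f', ⟨fun i k hik => ?_, fun i => ?_⟩, fun i hi => ?_, hG'N, by simp [f']⟩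
  · by_cases hk : k < N
    · simpa [G', hk, hik.trans hk] using h.1 i k hik
    · by_cases hi : i < N
      · simp only [G', hk, hi, if_true, if_false]
        refine ((hN i hi).trans_ssubset hE).trans_subset ?_
        rcases Nat.eq_zero_or_pos ((k : ℕ) - N) with h0 | h0
        · rw [h0, hT0]
        · exact hT0 ▸ (hT _ _ h0).1
      · simp only [G', hk, hi, if_false]
        refine hT _ _ ?_
        have h1 : (i : ℕ) < k := hik
        have h2 : (N : ℕ) ≤ i := not_lt.1 hi
        omega
  · by_cases hi : i < N
    · simpa [f', G', hi] using h.2 i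
    · by_cases hiN : i = N
      · subst hiN
        simpa [f', hG'N] using he
      · simpa only [f', hi, hiN, if_false] using (G' i).2.choose_spec
  · simp [G', f', hi]

/-- A chain sum is the sum over a block of a selection extending a given one. -/
theorem ChainSum.exists_selection {α : PosFin (ℕ+ → ℕ+) → ℕ+} {H : PosFin (ℕ+ → ℕ+) → PosFin ℕ+}
    {F : Finset (ℕ+ → ℕ+)} {E : PosFin (ℕ+ → ℕ+)} {x : ℕ+} (hx : ChainSum α H F E x)
    {G : ℕ+ → PosFin (ℕ+ → ℕ+)} {f : ℕ+ → ℕ+ → ℕ+} (h : IsSelection G f) {N : ℕ+}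
    (hN : ∀ i < N, (G i).1 ⊆ F) :
    ∃ G' f', IsSelection G' f' ∧ (∀ i < N, G' i = G i ∧ f' i = f i) ∧
      ∃ N', N ≤ N' ∧ (∀ i < N', (G' i).1 ⊆ E.1) ∧ ∃ β : PosFin ℕ+, (∀ i ∈ β.1, N ≤ i ∧ i < N') ∧
        blockSum α H G' f' β.1 = x := by
  classical
  induction hx with
  | @single E e hE he =>
    obtain ⟨G', f', h', hag, hG', hf'⟩ := h.exists_extend hN hE he
    refine ⟨G', f', h', hag, N + 1, (PNat.lt_add_right N 1).le, fun i hi => ?_,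
      ⟨{N}, Finset.singleton_nonempty N⟩, ?_, ?_⟩
    · rcases (PNat.lt_add_one_iff.1 hi).lt_or_eq with hi | rfl
      · exact (h'.1 i N hi).1.trans (by rw [hG'])
      · rw [hG']
    · simp
    · simp [blockSum, hG', hf']
  | @step E E' x e _ hE he ih =>
    obtain ⟨G₁, f₁, h₁, hag₁, N₁, hN₁, hsub, β, hβ, hsum⟩ := ih
    obtain ⟨G', f', h', hag, hG', hf'⟩ := h₁.exists_extend hsub hE he
    refine ⟨G', f', h', fun i hi => ?_, N₁ + 1, hN₁.trans (PNat.lt_add_right N₁ 1).le,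
      fun i hi => ?_, ⟨insert N₁ β.1, Finset.insert_nonempty _ _⟩, fun i hi => ?_, ?_⟩
    · rw [(hag i (hi.trans_le hN₁)).1, (hag i (hi.trans_le hN₁)).2]
      exact hag₁ i hi
    · rcases (PNat.lt_add_one_iff.1 hi).lt_or_eq with hi | rfl
      · exact (h'.1 i N₁ hi).1.trans (by rw [hG'])
      · rw [hG']
    · rcases Finset.mem_insert.1 hi with rfl | hi
      · exact ⟨hN₁, PNat.lt_add_right _ 1⟩
      · exact ⟨(hβ i hi).1, (hβ i hi).2.trans (PNat.lt_add_right _ 1)⟩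
    · have hnot : N₁ ∉ β.1 := fun hm => lt_irrefl _ (hβ _ hm).2
      have := blockSum_congr (α := α) (H := H) fun i hi => hag i (hβ i hi).2
      rw [blockSum, Finset.sum_insert hnot, ← blockSum, this, hsum, hG', hf', PNat.add_coe,
        add_comm]

/-- Each chain is laid out beyond the previous block, and later changes of the selection leave the
earlier blocks untouched. -/
theorem ConsecutiveChainSums.exists_selection : ∀ (m : ℕ)
    (α : Fin (m + 1) → PosFin (ℕ+ → ℕ+) → ℕ+) (H : Fin (m + 1) → PosFin (ℕ+ → ℕ+) → PosFin ℕ+)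
    (F : Finset (ℕ+ → ℕ+)) (x : Fin (m + 1) → ℕ+), ConsecutiveChainSums m α H F x →
    ∀ (G : ℕ+ → PosFin (ℕ+ → ℕ+)) (f : ℕ+ → ℕ+ → ℕ+), IsSelection G f →
    ∀ N : ℕ+, (∀ i < N, (G i).1 ⊆ F) →
    ∃ G' f', IsSelection G' f' ∧ (∀ i < N, G' i = G i ∧ f' i = f i) ∧
      ∃ β : Fin (m + 1) → PosFin ℕ+, (∀ j, ∀ i ∈ (β j).1, N ≤ i) ∧
        (∀ j k, j < k → Before (β j) (β k)) ∧
        ∀ j, blockSum (α j) (H j) G' f' (β j).1 = x j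
  | 0, α, H, F, x, hx, G, f, h, N, hN => by
      obtain ⟨E, hE⟩ := hx
      obtain ⟨G', f', h', hag, N', -, -, β, hβ, hsum⟩ := hE.exists_selection h hN
      refine ⟨G', f', h', hag, fun _ => β, fun _ i hi => (hβ i hi).1, fun j k hjk => ?_,
        fun j => ?_⟩
      · omega
      · rw [Fin.fin_one_eq_zero j]; exact hsum
  | m + 1, α, H, F, x, hx, G, f, h, N, hN => by
      obtain ⟨E, hE, hx'⟩ := hx
      obtain ⟨G₁, f₁, h₁, hag₁, N₁, hN₁, hsub, β₀, hβ₀, hsum⟩ := hE.exists_selection h hN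
      obtain ⟨G', f', h', hag, β, hβ, hbef, hsum'⟩ :=
        exists_selection m _ _ _ _ hx' G₁ f₁ h₁ N₁ hsub
      refine ⟨G', f', h', fun i hi => ?_, Fin.cons β₀ β, fun j => ?_, fun j k hjk => ?_,
        fun j => ?_⟩
      · rw [(hag i (hi.trans_le hN₁)).1, (hag i (hi.trans_le hN₁)).2]
        exact hag₁ i hi
      · refine Fin.cases ?_ (fun j => ?_) j
        · exact fun i hi => (hβ₀ i hi).1
        · exact fun i hi => hN₁.trans (hβ j i hi)
      · induction k using Fin.cases with
        | zero => simp at hjk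
        | succ k =>
          induction j using Fin.cases with
          | zero => exact fun s hs t ht => (hβ₀ s hs).2.trans_le (hβ k t ht)
          | succ j => exact hbef j k (Fin.succ_lt_succ_iff.1 hjk)
      · refine Fin.cases ?_ (fun j => ?_) j
        · rw [← hsum]
          exact blockSum_congr fun i hi => hag i (hβ₀ i hi).2
        · exact hsum' j

theorem exists_isSelection : ∃ G f, IsSelection G f := by
  obtain ⟨G₀, -⟩ := exists_ssuperset ∅
  obtain ⟨T, -, hT⟩ := exists_tower G₀
  exact ⟨fun i => T i, fun i => (T i).2.choose, fun i k h => hT _ _ h, fun i => (T i).2.choose_spec⟩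

/-- Sums over a block of a selection are chain sums. -/
theorem IsSelection.chainSum {G : ℕ+ → PosFin (ℕ+ → ℕ+)} {f : ℕ+ → ℕ+ → ℕ+}
    (h : IsSelection G f) (α : PosFin (ℕ+ → ℕ+) → ℕ+) (H : PosFin (ℕ+ → ℕ+) → PosFin ℕ+)
    {F : Finset (ℕ+ → ℕ+)} (β : PosFin ℕ+) (hF : ∀ i ∈ β.1, F ⊂ (G i).1) :
    ∃ x : ℕ+, (x : ℕ) = blockSum α H G f β.1 ∧ ∃ i ∈ β.1, ChainSum α H F (G i) x := by
  classical
  obtain ⟨β, hβ⟩ := β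
  suffices ∀ β : Finset ℕ+, (∀ i ∈ β, F ⊂ (G i).1) → β.Nonempty →
      ∃ x : ℕ+, (x : ℕ) = blockSum α H G f β ∧ ∃ i ∈ β, ChainSum α H F (G i) x from this β hF hβ
  clear hβ hF β
  intro β
  induction β using Finset.induction_on_max with
  | empty => exact fun _ h => absurd h (by simp)
  | insert n β hn ih =>
    intro hF _
    have hnot : n ∉ β := fun hm => lt_irrefl _ (hn _ hm)
    rcases β.eq_empty_or_nonempty with rfl | hne
    · exact ⟨_, by simp [blockSum], n, by simp, .single (hF n (by simp)) (h.2 n)⟩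
    · obtain ⟨x, hx, i, hi, hc⟩ := ih (fun i hi => hF i (Finset.mem_insert_of_mem hi)) hne
      refine ⟨_, ?_, n, by simp, hc.step (h.1 i n (hn i hi)) (h.2 n)⟩
      rw [PNat.add_coe, hx, blockSum, blockSum, Finset.sum_insert hnot, add_comm]

theorem IsSelection.consecutiveChainSums {G : ℕ+ → PosFin (ℕ+ → ℕ+)} {f : ℕ+ → ℕ+ → ℕ+}
    (h : IsSelection G f) : ∀ (m : ℕ) (α : Fin (m + 1) → PosFin (ℕ+ → ℕ+) → ℕ+)
    (H : Fin (m + 1) → PosFin (ℕ+ → ℕ+) → PosFin ℕ+) (F : Finset (ℕ+ → ℕ+))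
    (β : Fin (m + 1) → PosFin ℕ+), (∀ j k, j < k → Before (β j) (β k)) →
    (∀ j, ∀ i ∈ (β j).1, F ⊂ (G i).1) →
    ∃ x, ConsecutiveChainSums m α H F x ∧
      ∀ j, (x j : ℕ) = blockSum (α j) (H j) G f (β j).1
  | 0, α, H, F, β, _, hF => by
      obtain ⟨x, hx, i, -, hc⟩ := h.chainSum (α 0) (H 0) (β 0) (hF 0)
      exact ⟨fun _ => x, ⟨G i, hc⟩, fun j => by rw [Fin.fin_one_eq_zero j]; exact hx⟩
  | m + 1, α, H, F, β, hβ, hF => by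
      obtain ⟨x, hx, i, hi, hc⟩ := h.chainSum (α 0) (H 0) (β 0) (hF 0)
      obtain ⟨y, hy, hy'⟩ := consecutiveChainSums h m (fun j => α j.succ) (fun j => H j.succ)
        (G i).1 (fun j => β j.succ) (fun j k hjk => hβ _ _ (Fin.succ_lt_succ_iff.2 hjk))
        (fun j k hk => h.1 i k (hβ 0 j.succ (Fin.succ_pos j) i hi k hk))
      exact ⟨Fin.cons x y, ⟨G i, hc, hy⟩, Fin.cases hx hy'⟩

theorem isSelection_intMem_iff {m : ℕ} {a : Fin (m + 1) → ℕ+} {A : Set ℕ+}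
    {α : Fin (m + 1) → PosFin (ℕ+ → ℕ+) → ℕ+} {H : Fin (m + 1) → PosFin (ℕ+ → ℕ+) → PosFin ℕ+} :
    (∀ G f, IsSelection G f → ∀ β : Fin (m + 1) → PosFin ℕ+,
      (∀ j k, j < k → Before (β j) (β k)) →
      IntMem (∑ j, (a j : ℤ) * blockValue (α j) (H j) G f PolyZero.ident (β j)) A) ↔
    ∀ x, ConsecutiveChainSums m α H ∅ x → linCombValue m a x ∈ A := by
  have key : ∀ G f (β : Fin (m + 1) → PosFin ℕ+) (x : Fin (m + 1) → ℕ+),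
      (∀ j, blockSum (α j) (H j) G f (β j).1 = x j) →
      ∑ j, (a j : ℤ) * blockValue (α j) (H j) G f PolyZero.ident (β j) =
        ((linCombValue m a x : ℕ) : ℤ) := by
    intro G f β x hx
    rw [coe_linCombValue]
    simp [blockValue_ident, hx]
  constructor
  · intro h x hx
    -- Changes are allowed from place 1 on, so nothing of this selection has to survive.
    obtain ⟨G₀, f₀, h₀⟩ := exists_isSelection
    obtain ⟨G, f, hG, -, β, -, hβ, hsum⟩ :=
      hx.exists_selection _ _ _ _ _ G₀ f₀ h₀ 1 (fun i hi => (not_lt_one hi).elim)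
    exact (intMem_natCast (key G f β x hsum)).1 (h G f hG β hβ)
  · intro h G f hG β hβ
    obtain ⟨x, hx, hsum⟩ := hG.consecutiveChainSums m α H ∅ β hβ
      (fun j i _ => Finset.empty_ssubset.2 (G i).2)
    exact (intMem_natCast (key G f β x fun j => (hsum j).symm)).2 (h x hx)

theorem linearCombinationProperty_ident_iff {m : ℕ} {a : Fin (m + 1) → ℕ+} {A : Set ℕ+}
    {α : Fin (m + 1) → PosFin (ℕ+ → ℕ+) → ℕ+} {H : Fin (m + 1) → PosFin (ℕ+ → ℕ+) → PosFin ℕ+} :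
    LinearCombinationProperty ⟨{PolyZero.ident}, Finset.singleton_nonempty _⟩ a A α H ↔
    (∀ F G : PosFin (ℕ+ → ℕ+), F.1 ⊂ G.1 → ∀ j, Before (H j F) (H j G)) ∧
      ∀ x, ConsecutiveChainSums m α H ∅ x → linCombValue m a x ∈ A := by
  rw [← isSelection_intMem_iff, LinearCombinationProperty]
  refine and_congr_right fun _ => ⟨?_, ?_⟩
  · intro h G f hG β hβ
    exact h G hG.1 (fun _ => PolyZero.ident) (fun _ => Finset.mem_singleton_self _) β hβ f hG.2
  · intro h G hG P hP β hβ f hf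
    obtain rfl : P = fun _ => PolyZero.ident := funext fun j => Finset.mem_singleton.1 (hP j)
    exact h G f ⟨hG, hf⟩ β hβ

/-! ### Simultaneous choice of α and H -/

/-- Dependent choice along a well-founded relation. -/
theorem WellFounded.exists_forall_of_step {X D : Type*} {r : X → X → Prop} (wf : WellFounded r)
    (P : ∀ x, (∀ y, r y x → D) → D → Prop) (h : ∀ x g, ∃ d, P x g d) :
    ∃ W : X → D, ∀ x, P x (fun y _ => W y) (W x) := by
  choose d hd using h
  refine ⟨wf.fix d, fun x => ?_⟩
  rw [wf.fix_eq]
  exact hd _ _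

theorem finite_ssubset (F : PosFin (ℕ+ → ℕ+)) :
    Finite {G : PosFin (ℕ+ → ℕ+) // G.1 ⊂ F.1} := by
  refine Finite.of_injective
    (fun G : {G : PosFin (ℕ+ → ℕ+) // G.1 ⊂ F.1} => (⟨G.1.1, Finset.mem_powerset.2 G.2.1⟩ :
      {K // K ∈ F.1.powerset})) fun G G' h => ?_
  exact Subtype.ext (Subtype.ext (Subtype.mk.inj h))

/-- Given a system of states with moves which, from each good state, lead to good states for
members of some ultrafilter in `𝒥`, there are `α` and `H` whose values never leave the good
states. -/
theorem exists_strategy {ι X O : Type} [Finite O] (p : ι → Ultrafilter ℕ+)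
    (hp : ∀ k, p k ∈ JUltrafilters) (good : X → Prop) (next : O → X → ℕ+ → X) (idx : O → X → ι)
    (hnext : ∀ o s, good s → {z | good (next o s z)} ∈ p (idx o s)) (s₀ : X) (hs₀ : good s₀) :
    ∃ (α : ι → PosFin (ℕ+ → ℕ+) → ℕ+) (H : ι → PosFin (ℕ+ → ℕ+) → PosFin ℕ+)
      (St : Finset (ℕ+ → ℕ+) → Set X),
      (∀ F G : PosFin (ℕ+ → ℕ+), F.1 ⊂ G.1 → ∀ k, Before (H k F) (H k G)) ∧
      s₀ ∈ St ∅ ∧ (∀ F, ∀ s ∈ St F, good s) ∧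
      ∀ F, ∀ s ∈ St F, ∀ G : PosFin (ℕ+ → ℕ+), F ⊂ G.1 → ∀ f ∈ G.1, ∀ o,
        next o s (shiftedSum (α (idx o s) G) (H (idx o s) G) f) ∈ St G.1 := by
  classical
  cases nonempty_fintype O
  -- Data at one set: the shifts, the index sets, and a finite set of good states containing all
  -- those reached there.
  let D : Type := (ι → ℕ+) × (ι → PosFin ℕ+) × Finset {s // good s}
  obtain ⟨W, hW⟩ := WellFounded.exists_forall_of_step (D := D)
    (r := fun G F : PosFin (ℕ+ → ℕ+) => G.1 ⊂ F.1) (InvImage.wf Subtype.val wellFounded_lt)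
    (fun F g d => (∀ G h k, Before ((g G h).2.1 k) (d.2.1 k)) ∧
      (∀ f ∈ F.1, ∀ o, ∃ h, (⟨next o s₀ (shiftedSum (d.1 (idx o s₀)) (d.2.1 (idx o s₀)) f), h⟩ :
        {s // good s}) ∈ d.2.2) ∧
      ∀ G h, ∀ s ∈ (g G h).2.2, ∀ f ∈ F.1, ∀ o,
        ∃ h, (⟨next o s.1 (shiftedSum (d.1 (idx o s.1)) (d.2.1 (idx o s.1)) f), h⟩ :
          {s // good s}) ∈ d.2.2)
    (by
      intro F g
      have := finite_ssubset F
      cases nonempty_fintype {G : PosFin (ℕ+ → ℕ+) // G.1 ⊂ F.1}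
      -- The states from which a chain may step to `F`: the start, or those recorded at a nonempty
      -- proper subset.
      let S : Finset {s // good s} :=
        insert ⟨s₀, hs₀⟩ (Finset.univ.biUnion fun G : {G : PosFin (ℕ+ → ℕ+) // G.1 ⊂ F.1} =>
          (g G.1 G.2).2.2)
      have hC : ∀ k, {z | ∀ s ∈ S, ∀ o, idx o s.1 = k → good (next o s.1 z)} ∈ p k := by
        intro k
        have : {z | ∀ s ∈ S, ∀ o, idx o s.1 = k → good (next o s.1 z)} =
            ⋂ s ∈ S, ⋂ o : O, {z | idx o s.1 = k → good (next o s.1 z)} := by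
          ext; simp
        rw [this]
        refine (Filter.biInter_finset_mem S).2 fun s _ => Filter.iInter_mem.2 fun o => ?_
        by_cases ho : idx o s.1 = k
        · subst ho
          exact Filter.mem_of_superset (hnext o s.1 s.2) fun z hz _ => hz
        · exact Filter.mem_of_superset Filter.univ_mem fun z _ h => absurd h ho
      -- Index sets beyond `N` lie after all those already chosen at proper subsets.
      have hN : ∀ k, ∃ N : ℕ+, ∀ G h, ∀ t ∈ ((g G h).2.1 k).1, t ≤ N := by
        intro k
        obtain ⟨N, hN⟩ := (Finset.univ.biUnion
          fun G : {G : PosFin (ℕ+ → ℕ+) // G.1 ⊂ F.1} => ((g G.1 G.2).2.1 k).1).exists_le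
        exact ⟨N, fun G h t ht => hN t (Finset.mem_biUnion.2 ⟨⟨G, h⟩, Finset.mem_univ _, ht⟩)⟩
      choose N hN using hN
      choose b β hβ hb using fun k => (hp k _ (hC k)).exists_gt F (N k)
      have hgood : ∀ s ∈ S, ∀ f ∈ F.1, ∀ o,
          good (next o s.1 (shiftedSum (b (idx o s.1)) (β (idx o s.1)) f)) :=
        fun s hs f hf o => hb (idx o s.1) f hf s hs o rfl
      let S' : Finset {s // good s} := (Finset.univ : Finset (S × {f // f ∈ F.1} × O)).image
        fun q => ⟨_, hgood q.1.1 q.1.2 q.2.1.1 q.2.1.2 q.2.2⟩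
      have hS' : ∀ s ∈ S, ∀ f ∈ F.1, ∀ o, ∃ h,
          (⟨next o s.1 (shiftedSum (b (idx o s.1)) (β (idx o s.1)) f), h⟩ : {s // good s}) ∈ S' :=
        fun s hs f hf o => ⟨hgood s hs f hf o,
          Finset.mem_image.2 ⟨(⟨s, hs⟩, ⟨f, hf⟩, o), Finset.mem_univ _, rfl⟩⟩
      refine ⟨(b, β, S'), fun G h k s hs t ht => (hN k G h s hs).trans_lt (hβ k t ht),
        hS' ⟨s₀, hs₀⟩ (Finset.mem_insert_self _ _), fun G h s hs => hS' s ?_⟩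
      exact Finset.mem_insert_of_mem (Finset.mem_biUnion.2 ⟨⟨G, h⟩, Finset.mem_univ _, hs⟩))
  refine ⟨fun k G => (W G).1 k, fun k G => (W G).2.1 k,
    fun F => {s | (F = ∅ ∧ s = s₀) ∨ ∃ (h : F.Nonempty) (hs : good s), ⟨s, hs⟩ ∈ (W ⟨F, h⟩).2.2},
    fun F G h => (hW G).1 F h, Or.inl ⟨rfl, rfl⟩, ?_, ?_⟩
  · rintro F s (⟨-, rfl⟩ | ⟨-, hs, -⟩)
    exacts [hs₀, hs]
  · rintro F s (⟨rfl, rfl⟩ | ⟨hF, hs, hs'⟩) G hG f hf o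
    · obtain ⟨h, h'⟩ := (hW G).2.1 f hf o
      exact Or.inr ⟨G.2, h, h'⟩
    · obtain ⟨h, h'⟩ := (hW G).2.2 ⟨F, hF⟩ hG _ hs' f hf o
      exact Or.inr ⟨G.2, h, h'⟩

/-! ### Evaluating the linear combination state by state -/

/-- The elements `x` from which, after `a 0 x`, the remaining linear combination is in `A`. -/
def firstSection {ι : Type} (p : ι → Ultrafilter ℕ+) : (m : ℕ) → (Fin (m + 1) → ℕ+) →
    (Fin (m + 1) → ι) → Set ℕ+ → Set ℕ+
  | 0, a, _, A => {x | a 0 * x ∈ A}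
  | m + 1, a, c, A => {x | {z | a 0 * x + z ∈ A} ∈
      linCombUltrafilter m (fun i => a i.succ) (fun i => p (c i.succ))}

theorem mem_linCombUltrafilter_iff_firstSection {ι : Type} (p : ι → Ultrafilter ℕ+) :
    ∀ (m : ℕ) (a : Fin (m + 1) → ℕ+) (c : Fin (m + 1) → ι) (A : Set ℕ+),
    A ∈ linCombUltrafilter m a (fun j => p (c j)) ↔ firstSection p m a c A ∈ p (c 0)
  | 0, _, _, _ => Iff.rfl
  | _ + 1, _, _, _ => Iff.rfl

/-- A state in the evaluation of a linear combination: the linear combination that remains, its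
target set, and the part of its first block that is already fixed. -/
structure LinCombState (ι : Type) where
  m : ℕ
  a : Fin (m + 1) → ℕ+
  c : Fin (m + 1) → ι
  A : Set ℕ+
  y : Option ℕ+

namespace LinCombState

variable {ι : Type}

/-- The first block has been started within the section it must stay in, or nothing is fixed. -/
def Good (p : ι → Ultrafilter ℕ+) : LinCombState ι → Prop
  | ⟨m, a, c, A, none⟩ => firstSection p m a c A ∈ p (c 0)
  | ⟨m, a, c, A, some y⟩ => y ∈ firstSection p m a c A ∧
      {z | y + z ∈ firstSection p m a c A} ∈ p (c 0)

/-- Close the first block, if it is started and is not the last one. -/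
def close : LinCombState ι → LinCombState ι
  | ⟨m + 1, a, c, A, some y⟩ =>
      ⟨m, fun i => a i.succ, fun i => c i.succ, {z | a 0 * y + z ∈ A}, none⟩
  | s => s

/-- Add `z` to the first block. -/
def extend (s : LinCombState ι) (z : ℕ+) : LinCombState ι :=
  { s with y := some (s.y.elim z (· + z)) }

/-- Add `z` to the first block, which is closed before if the move is `true`. -/
def next (o : Bool) (s : LinCombState ι) (z : ℕ+) : LinCombState ι :=
  (bif o then s.close else s).extend z

/-- The index of the first block. -/
def firstIdx (s : LinCombState ι) : ι := s.c 0

/-- The index of the block that a move adds to. -/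
def idx (o : Bool) (s : LinCombState ι) : ι := (bif o then s.close else s).firstIdx

/-- A good started block lies in its section, which says exactly that the remaining combination is
still good. States that cannot be closed are unchanged, so every move is legal. -/
theorem Good.close {p : ι → Ultrafilter ℕ+} : ∀ {s : LinCombState ι}, s.Good p → s.close.Good p
  | ⟨0, _, _, _, none⟩, h => h
  | ⟨0, _, _, _, some _⟩, h => h
  | ⟨_ + 1, _, _, _, none⟩, h => h
  | ⟨_ + 1, _, _, _, some _⟩, h =>
      (mem_linCombUltrafilter_iff_firstSection p _ _ _ _).1 h.1

/-- The use of idempotence: almost every element of B can itself be prolonged within B. -/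
theorem mem_and_add_mem_of_idempotent {p : Ultrafilter ℕ+} (hp : p + p = p) {B : Set ℕ+}
    (hB : B ∈ p) : {z | z ∈ B ∧ {w | z + w ∈ B} ∈ p} ∈ p :=
  Filter.inter_mem hB (mem_add_ultrafilter.1 (hp.symm ▸ hB))

theorem Good.extend {p : ι → Ultrafilter ℕ+} (hp : ∀ k, p k + p k = p k) :
    ∀ {s : LinCombState ι}, s.Good p → {z | (s.extend z).Good p} ∈ p s.firstIdx
  | ⟨_, _, c, _, none⟩, h => mem_and_add_mem_of_idempotent (hp (c 0)) h
  | ⟨_, _, c, _, some y⟩, h => by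
      -- Idempotence is applied to the section translated by `-y`, which belongs to the ultrafilter
      -- by goodness.
      refine Filter.mem_of_superset (mem_and_add_mem_of_idempotent (hp (c 0)) h.2) fun z hz => ?_
      refine ⟨hz.1, Filter.mem_of_superset hz.2 fun w hw => ?_⟩
      change y + z + w ∈ firstSection p _ _ c _
      rw [add_assoc]
      exact hw

theorem Good.next {p : ι → Ultrafilter ℕ+} (hp : ∀ k, p k + p k = p k) (o : Bool)
    (s : LinCombState ι) (h : s.Good p) : {z | (next o s z).Good p} ∈ p (idx o s) := by
  cases o
  · exact h.extend hp
  · exact h.close.extend hp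

end LinCombState

section Strategy

variable {ι : Type} {p : ι → Ultrafilter ℕ+} {α : ι → PosFin (ℕ+ → ℕ+) → ℕ+}
  {H : ι → PosFin (ℕ+ → ℕ+) → PosFin ℕ+} {St : Finset (ℕ+ → ℕ+) → Set (LinCombState ι)}

/-- Only the first term of a chain may close an earlier block; the later terms merely extend the new
one. -/
theorem chainSum_mem_states
    (hSt : ∀ F, ∀ s ∈ St F, ∀ G : PosFin (ℕ+ → ℕ+), F ⊂ G.1 → ∀ f ∈ G.1, ∀ o,
      s.next o (shiftedSum (α (s.idx o) G) (H (s.idx o) G) f) ∈ St G.1)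
    {F : Finset (ℕ+ → ℕ+)} {s : LinCombState ι} (hs : s ∈ St F) {o : Bool} {m : ℕ}
    {a : Fin (m + 1) → ℕ+} {c : Fin (m + 1) → ι} {A : Set ℕ+}
    (ho : (bif o then s.close else s) = ⟨m, a, c, A, none⟩) {E : PosFin (ℕ+ → ℕ+)} {x : ℕ+}
    (hx : ChainSum (α (c 0)) (H (c 0)) F E x) : ⟨m, a, c, A, some x⟩ ∈ St E.1 := by
  induction hx with
  | @single G f hG hf =>
    have := hSt F s hs G hG f hf o
    rw [LinCombState.next, LinCombState.idx, ho] at this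
    exact this
  | @step E G x f _ hG hf ih => exact hSt _ _ ih G hG f hf false

/-- Each further coordinate starts with a closing move, which puts the value already fixed into the
target set. Goodness of the final state is then membership in `A`. -/
theorem linCombValue_mem_of_states (hgood : ∀ F, ∀ s ∈ St F, s.Good p)
    (hSt : ∀ F, ∀ s ∈ St F, ∀ G : PosFin (ℕ+ → ℕ+), F ⊂ G.1 → ∀ f ∈ G.1, ∀ o,
      s.next o (shiftedSum (α (s.idx o) G) (H (s.idx o) G) f) ∈ St G.1) :
    ∀ (m : ℕ) (a : Fin (m + 1) → ℕ+) (c : Fin (m + 1) → ι) (A : Set ℕ+)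
      (F : Finset (ℕ+ → ℕ+)) (s : LinCombState ι) (o : Bool), s ∈ St F →
      (bif o then s.close else s) = ⟨m, a, c, A, none⟩ → ∀ x : Fin (m + 1) → ℕ+,
      ConsecutiveChainSums m (fun j => α (c j)) (fun j => H (c j)) F x → linCombValue m a x ∈ A
  | 0, a, c, A, F, s, o, hs, ho, x, hx => by
      obtain ⟨E, hE⟩ := hx
      exact (hgood _ _ (chainSum_mem_states hSt hs ho hE)).1
  | m + 1, a, c, A, F, s, o, hs, ho, x, hx => by
      obtain ⟨E, hE, hx'⟩ := hx
      exact linCombValue_mem_of_states hgood hSt m _ _ _ E.1 _ true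
        (chainSum_mem_states hSt hs ho hE) rfl _ hx'

end Strategy

/-- The equivalence for coordinates `j` which use the ultrafilter and the functions of index
`c j`. -/
theorem exists_linearCombinationProperty_iff {ι : Type} {m : ℕ} (c : Fin (m + 1) → ι)
    (a : Fin (m + 1) → ℕ+) (A : Set ℕ+) :
    (∃ (α : ι → PosFin (ℕ+ → ℕ+) → ℕ+) (H : ι → PosFin (ℕ+ → ℕ+) → PosFin ℕ+),
      LinearCombinationProperty ⟨{PolyZero.ident}, Finset.singleton_nonempty _⟩ a A
        (fun j => α (c j)) (fun j => H (c j))) ↔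
    ∃ p : ι → Ultrafilter ℕ+, (∀ k, p k ∈ JUltrafilters ∧ p k + p k = p k) ∧
      A ∈ linCombUltrafilter m a (fun j => p (c j)) := by
  simp only [linearCombinationProperty_ident_iff]
  constructor
  · rintro ⟨α, H, -, h⟩
    choose p hpJ hpp hp using fun k => exists_idempotent_chainSum (α k) (H k)
    exact ⟨p, fun k => ⟨hpJ k, hpp k⟩, mem_linCombUltrafilter_of_consecutiveChainSums m a _ A _ _ ∅
      (fun j => hp (c j)) h⟩
  · rintro ⟨p, hp, hA⟩
    obtain ⟨α, H, St, hH, h₀, hgood, hSt⟩ := exists_strategy p (fun k => (hp k).1)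
      (LinCombState.Good p) LinCombState.next LinCombState.idx
      (LinCombState.Good.next fun k => (hp k).2) ⟨m, a, c, A, none⟩
      ((mem_linCombUltrafilter_iff_firstSection p m a c A).1 hA)
    exact ⟨α, H, fun F G h j => hH F G h (c j),
      linCombValue_mem_of_states hgood hSt m a c A ∅ _ false h₀ rfl⟩

/-- There are `m + 1` coefficients `a 0, …, a m`, so that their number is an arbitrary positive
integer. -/
theorem mainTheorem10 (m : ℕ) (a : Fin (m + 1) → ℕ+) (A : Set ℕ+) (T : PosFin PolyZero)
    (hT : T = ⟨{PolyZero.ident}, Finset.singleton_nonempty _⟩) :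
    (SingleConclusion T a A ↔
      ∃ p ∈ JUltrafilters, p + p = p ∧ A ∈ linCombUltrafilter m a (fun _ => p)) ∧
    (MultipleConclusion T a A ↔
      ∃ p : Fin (m + 1) → Ultrafilter ℕ+, (∀ j, p j ∈ JUltrafilters ∧ p j + p j = p j) ∧
        A ∈ linCombUltrafilter m a p) := by
  subst hT
  refine ⟨?_, exists_linearCombinationProperty_iff id a A⟩
  -- A one-point index type forces all coordinates to share one ultrafilter and one pair of
  -- functions.
  have h := exists_linearCombinationProperty_iff (fun _ : Fin (m + 1) => ()) a A
  constructor
  · rintro ⟨α, H, hαH⟩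
    obtain ⟨p, hp, hA⟩ := h.1 ⟨fun _ => α, fun _ => H, hαH⟩
    exact ⟨p (), (hp ()).1, (hp ()).2, hA⟩
  · rintro ⟨p, hpJ, hpp, hA⟩
    obtain ⟨α, H, hαH⟩ := h.2 ⟨fun _ => p, fun _ => ⟨hpJ, hpp⟩, hA⟩
    exact ⟨α (), H (), hαH⟩
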